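/- Let $M$ be the line $\mathbb{R}$, the circle $S^1$, or the closed interval $I=[0,1]$, and let $\mathrm{Diff}^1(M)$ denote the group, under composition, of all orientation-preserving $C^1$ diffeomorphisms of $M$ (bijections $f:M\to M$ such that $f$ and $f^{-1}$ are both $C^1$, with one-sided derivatives at the endpoints when $M=I$). Then every finitely generated, torsion-free nilpotent group is isomorphic to a subgroup of $\mathrm{Diff}^1(M)$. (A group is torsion-free if its only element of finite order is the identity.) -/

import Mathlib

open scoped Manifold ContDiff

noncomputable section

/-- The group `Diff^r(M)` of all `C^r` diffeomorphisms of a manifold `M`, under composition. -/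
instance Diffeomorph.instGroup {𝕜 : Type*} [NontriviallyNormedField 𝕜] {E : Type*}
    [NormedAddCommGroup E] [NormedSpace 𝕜 E] {H : Type*} [TopologicalSpace H]
    {J : ModelWithCorners 𝕜 E H} {M : Type*} [TopologicalSpace M] [ChartedSpace H M]
    {r : ℕ∞ω} : Group (Diffeomorph J J M M r) where
  mul f g := g.trans f
  one := Diffeomorph.refl J M r
  inv f := f.symm
  mul_assoc _ _ _ := Diffeomorph.ext fun _ => rfl
  one_mul _ := Diffeomorph.ext fun _ => rfl
  mul_one _ := Diffeomorph.ext fun _ => rfl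
  inv_mul_cancel f := Diffeomorph.ext fun x => f.symm_apply_apply x

/-- `Diff^1(ℝ)`: the orientation-preserving `C^1` diffeomorphisms of the line. -/
def DiffOneLine : Subgroup (Diffeomorph 𝓘(ℝ, ℝ) 𝓘(ℝ, ℝ) ℝ ℝ 1) where
  carrier := {f | StrictMono f}
  mul_mem' {_ _} hf hg := fun _ _ h => hf (hg h)
  one_mem' := strictMono_id
  inv_mem' {f} hf := fun x y h => by
    have hf' : StrictMono f := hf
    refine hf'.lt_iff_lt.1 ?_
    change f (f.symm x) < f (f.symm y)
    simpa using h

/-- `Diff^1([0,1])`: the orientation-preserving `C^1` diffeomorphisms of the closed unit interval,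
which is a manifold with boundary (so derivatives at the end points are one-sided). -/
def DiffOneInterval :
    Subgroup (Diffeomorph (𝓡∂ 1) (𝓡∂ 1) (Set.Icc (0 : ℝ) 1) (Set.Icc (0 : ℝ) 1) 1) where
  carrier := {f | StrictMono f}
  mul_mem' {_ _} hf hg := fun _ _ h => hf (hg h)
  one_mem' := strictMono_id
  inv_mem' {f} hf := fun x y h => by
    have hf' : StrictMono f := hf
    refine hf'.lt_iff_lt.1 ?_
    change f (f.symm x) < f (f.symm y)
    simpa using h

/-- `Diff^1(S^1)`: the orientation-preserving `C^1` diffeomorphisms of the circle. A diffeomorphism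
of the circle preserves orientation when it lifts, through the universal covering
`t ↦ exp (i t)`, to an increasing bijection of the line. -/
def DiffOneCircle : Subgroup (Diffeomorph (𝓡 1) (𝓡 1) Circle Circle 1) where
  carrier := {f | ∃ F : ℝ ≃o ℝ, ∀ t : ℝ, f (Circle.exp t) = Circle.exp (F t)}
  mul_mem' := by
    rintro f g ⟨F, hF⟩ ⟨G, hG⟩
    refine ⟨G.trans F, fun t => ?_⟩
    change f (g (Circle.exp t)) = Circle.exp (F (G t))
    rw [hG, hF]
  one_mem' := ⟨OrderIso.refl ℝ, fun _ => rfl⟩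
  inv_mem' := by
    rintro f ⟨F, hF⟩
    refine ⟨F.symm, fun t => ?_⟩
    change f.symm (Circle.exp t) = Circle.exp (F.symm t)
    have h := hF (F.symm t)
    rw [F.apply_symm_apply] at h
    rw [← h, Diffeomorph.symm_apply_apply]

end

/-! One faithful action on the line by increasing `C^1` diffeomorphisms supported in `[0,1]`
suffices: restrict it to the interval, or close it up to the circle. The action is of Denjoy type.
Disjoint open intervals, one gap for each `x` in `N`, are laid out in `[0,1]` following a
left-invariant order, and `g` carries the gap of `x` to the gap of `g * x`.

The gap of `x` has length `π * l x`, the lengths add up to 1, and so the gaps are dense and have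
full measure. Each gap is parametrized by the line with speed `l x ^ 2 / (1 + (l x * u) ^ 2)`, and
`g` matches equal parameters `u`; composition is then automatic. As this speed is asymptotic to `1 /
u ^ 2` whatever `l x` is, the derivative of `g` tends to 1 at the ends of each gap. Inside the gap
it lies between 1 and `(l (g * x) / l x) ^ 2`. Hence `g` is `C^1` if `l x / l (g * x)` tends to 1 at
infinity in `N`.

Nilpotency supplies both ingredients. Torsion-freeness gives the order
(`exists_linearOrder_mul_left_lt`). Polynomial growth (`hasPolynomialGrowth_of_isNilpotent`) makes a
negative power of the word length summable, and such a power is asymptotically invariant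
(`exists_summable_tendsto_div`). -/

open scoped Pointwise
open Filter Topology MeasureTheory Real

/-! ### Left orders on torsion-free nilpotent groups -/

/-- A positive cone of a left-invariant linear order on a group. -/
structure IsPositiveCone {G : Type*} [Group G] (P : Set G) : Prop where
  one_notMem : (1 : G) ∉ P
  mul_mem : ∀ a ∈ P, ∀ b ∈ P, a * b ∈ P
  mem_or_inv_mem : ∀ a, a ≠ 1 → a ∈ P ∨ a⁻¹ ∈ P

/-- A torsion-free abelian group embeds in a rational vector space, its divisible hull, which is
ordered lexicographically by coordinates in a basis. -/
theorem exists_isPositiveCone_of_comm {A : Type*} [Group A] (hcomm : ∀ a b : A, a * b = b * a)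
    (h : ∀ a : A, IsOfFinOrder a → a = 1) : ∃ P : Set A, IsPositiveCone P := by
  let _ : CommGroup A := { ‹Group A› with mul_comm := hcomm }
  have : IsMulTorsionFree A := .of_not_isOfFinOrder fun a ha hfin => ha (h a hfin)
  have hinj : Function.Injective (DivisibleHull.coeAddMonoidHom (M := Additive A)) :=
    DivisibleHull.coe_injective
  classical
  let b := Module.Basis.ofVectorSpace ℚ (DivisibleHull (Additive A))
  let _ : LinearOrder (Module.Basis.ofVectorSpaceIndex ℚ (DivisibleHull (Additive A))) :=
    linearOrderOfSTO WellOrderingRel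
  let f : Additive A →+ Lex (_ →₀ ℚ) :=
    b.repr.toAddEquiv.toAddMonoidHom.comp (DivisibleHull.coeAddMonoidHom (M := Additive A))
  have hf : Function.Injective f := b.repr.injective.comp hinj
  refine ⟨{a | 0 < f (Additive.ofMul a)}, ?_, ?_, ?_⟩
  · simp
  · intro a ha c hc
    simp only [Set.mem_ofPred_eq, ofMul_mul, map_add] at *
    exact add_pos ha hc
  · intro a ha
    simp only [Set.mem_ofPred_eq, ofMul_inv, map_neg]
    have : f (Additive.ofMul a) ≠ 0 := by
      intro h0
      exact ha (Additive.ofMul.injective (hf (h0.trans (map_zero f).symm)))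
    rcases lt_or_gt_of_ne this with h1 | h1
    · right; exact neg_pos.2 h1
    · left; exact h1

/-- If the commutator `c` of `y` and `x` is central, then `c ^ n` is the commutator of `y` and `x ^
n`, hence trivial when `x ^ n` is central. Assuming only that the centre is torsion-free lets the
induction on the central series pass to the quotient. -/
theorem eq_one_of_mem_center_quotient_center {G : Type*} [Group G]
    (h : ∀ z ∈ Subgroup.center G, IsOfFinOrder z → z = 1) :
    ∀ z ∈ Subgroup.center (G ⧸ Subgroup.center G), IsOfFinOrder z → z = 1 := by
  intro z hz hfin
  obtain ⟨x, rfl⟩ := QuotientGroup.mk_surjective z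
  obtain ⟨n, hn, hxn⟩ := isOfFinOrder_iff_pow_eq_one.1 hfin
  rw [← QuotientGroup.mk_pow, QuotientGroup.eq_one_iff] at hxn
  rw [QuotientGroup.eq_one_iff, Subgroup.mem_center_iff]
  intro y
  have hc : y * x * y⁻¹ * x⁻¹ ∈ Subgroup.center G := by
    rw [← QuotientGroup.eq_one_iff]
    have := Subgroup.mem_center_iff.1 hz (y : G ⧸ Subgroup.center G)
    simp only [QuotientGroup.mk_mul, QuotientGroup.mk_inv, this]
    group
  set c := y * x * y⁻¹ * x⁻¹ with hcdef
  have h1 : c * x = y * x * y⁻¹ := by rw [hcdef]; group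
  have hcx : Commute c x := (Subgroup.mem_center_iff.1 hc x).symm
  have h2 : c ^ n * x ^ n = x ^ n := by
    rw [← hcx.mul_pow, h1, conj_pow, Subgroup.mem_center_iff.1 hxn y, mul_inv_cancel_right]
  have h3 : c = 1 := h c hc (isOfFinOrder_iff_pow_eq_one.2 ⟨n, hn, by simpa using h2⟩)
  rw [h3, one_mul] at h1
  exact (eq_mul_inv_iff_mul_eq.1 h1).symm

/-- Lexicographic order: the sign is read in the quotient, and in the centre when the quotient gives
1. -/
theorem exists_isPositiveCone_of_center_quotient {G : Type*} [Group G]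
    (hZ : ∃ P : Set (Subgroup.center G), IsPositiveCone P)
    (hQ : ∃ P : Set (G ⧸ Subgroup.center G), IsPositiveCone P) :
    ∃ P : Set G, IsPositiveCone P := by
  obtain ⟨P, hP⟩ := hZ
  obtain ⟨Q, hQ⟩ := hQ
  refine ⟨{g | (g : G ⧸ Subgroup.center G) ∈ Q ∨ ∃ z ∈ P, (z : G) = g}, ?_, ?_, ?_⟩
  · rintro (h | ⟨z, hz, h⟩)
    · exact hQ.one_notMem h
    · exact hP.one_notMem (by rwa [show z = 1 from Subtype.ext h] at hz)
  · have key : ∀ z : Subgroup.center G, ((z : G) : G ⧸ Subgroup.center G) = 1 := fun z =>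
      (QuotientGroup.eq_one_iff _).2 z.2
    rintro a (ha | ⟨z, hz, rfl⟩) b (hb | ⟨w, hw, rfl⟩)
    · exact Or.inl (hQ.mul_mem _ ha _ hb)
    · left; rwa [QuotientGroup.mk_mul, key, mul_one]
    · left; rwa [QuotientGroup.mk_mul, key, one_mul]
    · exact Or.inr ⟨z * w, hP.mul_mem _ hz _ hw, rfl⟩
  · intro a ha
    by_cases h : (a : G ⧸ Subgroup.center G) = 1
    · have haz := (QuotientGroup.eq_one_iff _).1 h
      rcases hP.mem_or_inv_mem ⟨a, haz⟩ (fun h => ha (congrArg Subtype.val h)) with h1 | h1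
      · exact Or.inl (Or.inr ⟨_, h1, rfl⟩)
      · exact Or.inr (Or.inr ⟨_, h1, rfl⟩)
    · rcases hQ.mem_or_inv_mem _ h with h1 | h1
      · exact Or.inl (Or.inl h1)
      · exact Or.inr (Or.inl h1)

theorem exists_isPositiveCone_of_isNilpotent {G : Type*} [Group G] [Group.IsNilpotent G]
    (h : ∀ z ∈ Subgroup.center G, IsOfFinOrder z → z = 1) :
    ∃ P : Set G, IsPositiveCone P := by
  revert h
  refine Group.nilpotent_center_quotient_ind
    (P := fun G _ _ => (∀ z ∈ Subgroup.center G, IsOfFinOrder z → z = 1) →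
      ∃ P : Set G, IsPositiveCone P) G ?_ ?_
  · intro G _ _ _
    exact ⟨∅, fun h => h, fun _ h => h.elim, fun a ha => (ha (Subsingleton.elim _ _)).elim⟩
  · intro G _ _ ih h
    refine exists_isPositiveCone_of_center_quotient (exists_isPositiveCone_of_comm
      (fun a b => Subtype.ext (Subgroup.mem_center_iff.1 b.2 a)) ?_)
      (ih (eq_one_of_mem_center_quotient_center h))
    intro a ha
    exact Subtype.ext (h a a.2 ((Subgroup.center G).subtype.isOfFinOrder ha))

/-- A torsion-free nilpotent group carries a left-invariant linear order. -/
theorem exists_linearOrder_mul_left_lt {G : Type*} [Group G] [Group.IsNilpotent G]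
    (h : ∀ g : G, IsOfFinOrder g → g = 1) :
    ∃ _ : LinearOrder G, ∀ g x y : G, x < y → g * x < g * y := by
  obtain ⟨P, hP⟩ := exists_isPositiveCone_of_isNilpotent (G := G) fun z _ => h z
  classical
  let r : G → G → Prop := fun x y => x⁻¹ * y ∈ P
  have : IsStrictTotalOrder G r :=
    { trichotomous := by
        intro a b hab hba
        by_contra hne
        rcases hP.mem_or_inv_mem (a⁻¹ * b) (fun h => hne (inv_mul_eq_one.1 h)) with h1 | h1
        · exact hab h1
        · exact hba (by simpa [r] using h1)
      irrefl := fun a ha => hP.one_notMem (by simpa [r] using ha)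
      trans := fun a b c hab hbc => by
        have := hP.mul_mem _ hab _ hbc
        simpa [r, mul_assoc] using this }
  refine ⟨linearOrderOfSTO r, fun g x y hxy => ?_⟩
  change (g * x)⁻¹ * (g * y) ∈ P
  have : x⁻¹ * y ∈ P := hxy
  simpa [mul_assoc] using this

/-! ### Polynomial growth of nilpotent groups -/

/-- The number of products of `n` elements of `S` is at most polynomial in `n`. -/
def HasPolynomialGrowth {G : Type*} [Group G] (S : Set G) : Prop :=
  ∃ C d : ℕ, ∀ n : ℕ, (S ^ n).Finite ∧ (S ^ n).ncard ≤ C * (n + 1) ^ d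

theorem Set.pow_subset_pow_of_subset {M : Type*} [Monoid M] {S T : Set M} (h : S ⊆ T) (n : ℕ) :
    S ^ n ⊆ T ^ n := by
  induction n with
  | zero => simp
  | succ n ih => rw [pow_succ, pow_succ]; exact Set.mul_subset_mul ih h

theorem HasPolynomialGrowth.mono {G : Type*} [Group G] {S T : Set G}
    (hT : HasPolynomialGrowth T) (h : S ⊆ T) : HasPolynomialGrowth S := by
  obtain ⟨C, d, hC⟩ := hT
  refine ⟨C, d, fun n => ?_⟩
  have hs := Set.pow_subset_pow_of_subset h n
  exact ⟨(hC n).1.subset hs, (Set.ncard_le_ncard hs (hC n).1).trans (hC n).2⟩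

/-- One more conjugation by `s` multiplies `s⁻ʲ t sʲ` by the same conjugate of the commutator of `t`
and `s`, which dies after one iteration fewer. A double induction bounds the length by a polynomial
in `j`. -/
theorem conj_pow_mem_pow {G : Type*} [Group G] (s : G) {T : Set G} (h1 : 1 ∈ T)
    (hT : ∀ t ∈ T, t⁻¹ * s⁻¹ * t * s ∈ T) (m : ℕ) :
    ∀ t ∈ T, (fun t => t⁻¹ * s⁻¹ * t * s)^[m] t = 1 →
      ∀ j : ℕ, (s ^ j)⁻¹ * t * s ^ j ∈ T ^ (1 + j) ^ m := by
  induction m with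
  | zero =>
    rintro t - ht j
    simp only [Function.iterate_zero, id_eq] at ht
    simpa [ht] using h1
  | succ m ih =>
    intro t htT ht j
    induction j with
    | zero => simpa using htT
    | succ j ihj =>
      have h2 := ih _ (hT t htT) (by simpa only [Function.iterate_succ_apply] using ht) j
      have h3 := Set.mul_mem_mul ihj h2
      rw [← pow_add] at h3
      have h4 : (s ^ (j + 1))⁻¹ * t * s ^ (j + 1) =
          (s ^ j)⁻¹ * t * s ^ j * ((s ^ j)⁻¹ * (t⁻¹ * s⁻¹ * t * s) * s ^ j) := by
        rw [pow_succ' s j]; group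
      rw [h4]
      refine Set.pow_subset_pow_right h1 ?_ h3
      calc (1 + j) ^ (m + 1) + (1 + j) ^ m = (1 + j) ^ m * (1 + (j + 1)) := by ring
        _ ≤ (1 + (j + 1)) ^ m * (1 + (j + 1)) := by gcongr; omega
        _ = _ := by ring

/-- All letters `s` of a word are collected on the left; each remaining letter becomes a conjugate
by a power of `s` of exponent at most `n`, so has `T`-length at most `(n + 1) ^ m`. -/
theorem insert_pow_subset {G : Type*} [Group G] (s : G) {T : Set G} (h1 : 1 ∈ T)
    (hT : ∀ t ∈ T, t⁻¹ * s⁻¹ * t * s ∈ T) (m : ℕ)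
    (hm : ∀ t ∈ T, (fun t => t⁻¹ * s⁻¹ * t * s)^[m] t = 1) (n : ℕ) :
    insert s T ^ n ⊆
      (fun p : ℕ × G => s ^ p.1 * p.2) '' ((Finset.range (n + 1) : Set ℕ) ×ˢ
        (T ^ (n * (n + 1) ^ m))) := by
  induction n with
  | zero =>
    intro x hx
    exact ⟨(0, 1), by simp, by simpa using hx.symm⟩
  | succ n ih =>
    rw [pow_succ']
    rintro _ ⟨x, hx, w, hw, rfl⟩
    obtain ⟨⟨j, h⟩, ⟨hj, hh⟩, rfl⟩ := ih hw
    simp only [Finset.coe_range, Set.mem_Iio] at hj hh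
    have hle : n * (n + 1) ^ m + (n + 1) ^ m ≤ (n + 1) * (n + 1 + 1) ^ m := by
      calc n * (n + 1) ^ m + (n + 1) ^ m = (n + 1) * (n + 1) ^ m := by ring
        _ ≤ _ := by gcongr; omega
    rcases hx with rfl | hx
    · refine ⟨(j + 1, h), ⟨by simpa using hj, ?_⟩, by simp [pow_succ', mul_assoc]⟩
      exact Set.pow_subset_pow_right h1 (le_trans (Nat.le_add_right _ _) hle) hh
    · refine ⟨(j, (s ^ j)⁻¹ * x * s ^ j * h), ⟨by simp; omega, ?_⟩, ?_⟩
      · have h2 := conj_pow_mem_pow s h1 hT m x hx (hm x hx) j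
        have h3 := Set.mul_mem_mul h2 hh
        rw [← pow_add] at h3
        refine Set.pow_subset_pow_right h1 (le_trans ?_ hle) h3
        have h4 : (1 + j) ^ m ≤ (n + 1) ^ m := Nat.pow_le_pow_left (by omega) m
        omega
      · simp only; group

/-- In the collected form there are `n + 1` choices for the exponent of `s`, and polynomially many
for the other factor, whose length is polynomial in `n`. -/
theorem HasPolynomialGrowth.insert {G : Type*} [Group G] (s : G) {T : Set G}
    (hg : HasPolynomialGrowth T) (h1 : 1 ∈ T)
    (hT : ∀ t ∈ T, t⁻¹ * s⁻¹ * t * s ∈ T) (m : ℕ)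
    (hm : ∀ t ∈ T, (fun t => t⁻¹ * s⁻¹ * t * s)^[m] t = 1) :
    HasPolynomialGrowth (insert s T) := by
  obtain ⟨C, d, hC⟩ := hg
  refine ⟨C, 1 + (m + 1) * d, fun n => ?_⟩
  have hsub := insert_pow_subset s h1 hT m hm n
  have hfin : ((Finset.range (n + 1) : Set ℕ) ×ˢ (T ^ (n * (n + 1) ^ m))).Finite :=
    (Finset.finite_toSet _).prod (hC _).1
  refine ⟨(hfin.image _).subset hsub, ?_⟩
  refine (Set.ncard_le_ncard hsub (hfin.image _)).trans ((Set.ncard_image_le hfin).trans ?_)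
  rw [Set.ncard_prod, Set.ncard_coe_finset, Finset.card_range]
  have h2 : n * (n + 1) ^ m + 1 ≤ (n + 1) ^ (m + 1) := by
    have : 1 ≤ (n + 1) ^ m := Nat.one_le_pow _ _ (by omega)
    calc n * (n + 1) ^ m + 1 ≤ n * (n + 1) ^ m + (n + 1) ^ m := by omega
      _ = _ := by ring
  calc (n + 1) * (T ^ (n * (n + 1) ^ m)).ncard
      ≤ (n + 1) * (C * (n * (n + 1) ^ m + 1) ^ d) := by gcongr; exact (hC _).2
    _ ≤ (n + 1) * (C * ((n + 1) ^ (m + 1)) ^ d) := by gcongr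
    _ = _ := by rw [← pow_mul]; ring

theorem iterate_commutator_mem_lowerCentralSeries {G : Type*} [Group G] (s : G) {i : ℕ} {t : G}
    (ht : t ∈ (⊤ : Subgroup G).lowerCentralSeries i) (k : ℕ) :
    (fun t => t⁻¹ * s⁻¹ * t * s)^[k] t ∈ (⊤ : Subgroup G).lowerCentralSeries (i + k) := by
  induction k with
  | zero => simpa using ht
  | succ k ih =>
    rw [Function.iterate_succ_apply', ← add_assoc, Subgroup.lowerCentralSeries_succ]
    have := Subgroup.commutator_mem_commutator (inv_mem ih) (Subgroup.mem_top s⁻¹)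
    simpa only [commutatorElement_def, inv_inv] using this

/-- The elements `s` of `A` are added one at a time. Collecting `s` requires a set closed under
commutators with `s`; the missing commutators lie one step down the series, so they can be put into
`B`. This is why `B` is arbitrary in the induction. -/
theorem HasPolynomialGrowth.of_subset_lowerCentralSeries {G : Type*} [Group G] {c : ℕ}
    (hc : (⊤ : Subgroup G).lowerCentralSeries c = ⊥) (i : ℕ)
    (ih : ∀ B : Set G, B.Finite → B ⊆ (⊤ : Subgroup G).lowerCentralSeries (i + 1) →
      HasPolynomialGrowth B) {A : Set G} (hA : A.Finite) :
    A ⊆ (⊤ : Subgroup G).lowerCentralSeries i → ∀ B : Set G, B.Finite → 1 ∈ B →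
      B ⊆ (⊤ : Subgroup G).lowerCentralSeries (i + 1) → HasPolynomialGrowth (A ∪ B) := by
  induction A, hA using Set.Finite.induction_on with
  | empty =>
    intro _ B hB _ hBs
    simpa using ih B hB hBs
  | @insert s A _ hA ihA =>
    intro hAs B hB h1 hBs
    have hAs' := (Set.subset_insert s A).trans hAs
    have hanti := (⊤ : Subgroup G).lowerCentralSeries_antitone
    have hABs : A ∪ B ⊆ (⊤ : Subgroup G).lowerCentralSeries i :=
      Set.union_subset hAs' (hBs.trans (hanti (Nat.le_succ i)))
    have hvan : ∀ t ∈ (⊤ : Subgroup G).lowerCentralSeries i, ∀ k, c ≤ k →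
        (fun t => t⁻¹ * s⁻¹ * t * s)^[k] t = 1 := by
      intro t ht k hk
      have := hanti (show c ≤ i + k by omega) (iterate_commutator_mem_lowerCentralSeries s ht k)
      rwa [hc, Subgroup.mem_bot] at this
    -- Finitely many iterates suffice: from the `c`-th on they are all 1, which is in `B`.
    let B' : Set G := B ∪ ⋃ k ∈ Finset.range c,
      (fun t => t⁻¹ * s⁻¹ * t * s)^[k + 1] '' (A ∪ B)
    have hB'mem : ∀ x, x ∈ B' ↔ x ∈ B ∨ ∃ k < c, ∃ t ∈ A ∪ B,
        (fun t => t⁻¹ * s⁻¹ * t * s)^[k + 1] t = x := by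
      intro x
      simp only [B', Set.mem_union, Set.mem_iUnion, Set.mem_image, Finset.mem_range, exists_prop]
    have hB'fin : B'.Finite := hB.union
      ((Finset.range c).finite_toSet.biUnion fun k _ => (hA.union hB).image _)
    have hB's : B' ⊆ (⊤ : Subgroup G).lowerCentralSeries (i + 1) := by
      intro x hx
      rcases (hB'mem x).1 hx with hx | ⟨k, _, t, ht, rfl⟩
      · exact hBs hx
      · exact hanti (by omega) (iterate_commutator_mem_lowerCentralSeries s (hABs ht) (k + 1))
    have hg := ihA hAs' B' hB'fin (Or.inl h1) hB's
    have hT : ∀ t ∈ A ∪ B', t⁻¹ * s⁻¹ * t * s ∈ A ∪ B' := by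
      intro t ht
      right
      have key : ∀ t ∈ A ∪ B, ∀ k, (fun t => t⁻¹ * s⁻¹ * t * s)^[k + 1] t ∈ B' := by
        intro t ht k
        rw [hB'mem]
        by_cases hk : k < c
        · exact Or.inr ⟨k, hk, t, ht, rfl⟩
        · left; rwa [hvan t (hABs ht) (k + 1) (by omega)]
      rcases ht with ht | ht
      · exact key t (Or.inl ht) 0
      · rcases (hB'mem t).1 ht with ht | ⟨k, _, u, hu, rfl⟩
        · exact key t (Or.inr ht) 0
        · have := key u hu (k + 1)
          rwa [Function.iterate_succ_apply'] at this
    refine (hg.insert s (Or.inr (Or.inl h1)) hT c fun t ht => hvan t ?_ c le_rfl).mono ?_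
    · rcases ht with ht | ht
      · exact hAs' ht
      · exact hanti (Nat.le_succ i) (hB's ht)
    · rw [Set.insert_union]
      exact Set.insert_subset_insert (Set.union_subset_union_right _ Set.subset_union_left)

/-- Every finite subset of a nilpotent group has polynomial growth. -/
theorem hasPolynomialGrowth_of_isNilpotent {G : Type*} [Group G] [Group.IsNilpotent G]
    {S : Set G} (hS : S.Finite) : HasPolynomialGrowth S := by
  obtain ⟨c, hc⟩ := Subgroup.nilpotent_iff_lowerCentralSeries.1 ‹Group.IsNilpotent G›
  -- Induction up the lower central series, starting from its trivial term at index `c`.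
  have hall : ∀ j ≤ c, ∀ B : Set G, B.Finite →
      B ⊆ (⊤ : Subgroup G).lowerCentralSeries (c - j) → HasPolynomialGrowth B := by
    intro j
    induction j with
    | zero =>
      intro _ B _ hBs
      refine ⟨1, 0, fun n => ?_⟩
      have h1 : B ⊆ {1} := by simpa [hc] using hBs
      have h2 : B ^ n ⊆ {1} := (Set.pow_subset_pow_of_subset h1 n).trans (by simp)
      exact ⟨(Set.finite_singleton 1).subset h2, by simpa using Set.ncard_le_ncard h2⟩
    | succ j ih =>
      intro hj B hB hBs
      have hij : c - (j + 1) + 1 = c - j := by omega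
      refine (HasPolynomialGrowth.of_subset_lowerCentralSeries hc (c - (j + 1))
        (fun B' hB' hBs' => ih (by omega) B' hB' (hij ▸ hBs')) hB hBs {1} (Set.finite_singleton 1)
        rfl ?_).mono Set.subset_union_left
      simp
  exact hall c le_rfl S hS (by simp)

theorem exists_mem_pow_of_closure_eq_top {G : Type*} [Group G] {S : Set G}
    (hinv : S⁻¹ = S) (hS : Subgroup.closure S = ⊤) (g : G) : ∃ n : ℕ, g ∈ S ^ n := by
  have hg : g ∈ Subgroup.closure S := hS ▸ Subgroup.mem_top g
  induction hg using Subgroup.closure_induction with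
  | mem x hx => exact ⟨1, by simpa using hx⟩
  | one => exact ⟨0, by simp⟩
  | mul x y _ _ hx hy =>
    obtain ⟨m, hm⟩ := hx
    obtain ⟨n, hn⟩ := hy
    exact ⟨m + n, by rw [pow_add]; exact Set.mul_mem_mul hm hn⟩
  | inv x _ hx =>
    obtain ⟨n, hn⟩ := hx
    refine ⟨n, ?_⟩
    rw [← hinv, inv_pow]
    simpa using hn

/-! ### Word length and the asymptotically invariant weight -/

/-- A finitely generated nilpotent group carries a proper, integer-valued length function with
polynomially growing balls, which each left translation changes by a bounded amount. -/
theorem exists_length_of_isNilpotent {G : Type*} [Group G] [Group.IsNilpotent G]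
    (hfg : Group.FG G) : ∃ (len : G → ℕ) (C d : ℕ),
      (∀ n, {x | len x ≤ n}.Finite ∧ {x | len x ≤ n}.ncard ≤ C * (n + 1) ^ d) ∧
      ∀ g, ∃ K, ∀ x, len (g * x) ≤ len x + K := by
  obtain ⟨_, S₀, _, hS₀⟩ := Group.fg_iff'.1 hfg
  -- Symmetry makes the powers of `S` exhaust `G`; containing 1 makes them increasing, so that they
  -- are the balls of the word length.
  let S : Set G := insert 1 (↑S₀ ∪ (↑S₀)⁻¹)
  have hfin : S.Finite := (S₀.finite_toSet.union S₀.finite_toSet.inv).insert 1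
  have h1 : (1 : G) ∈ S := Set.mem_insert _ _
  have hinv : S⁻¹ = S := by
    ext x
    simp [S, or_comm]
  have hcl : Subgroup.closure S = ⊤ :=
    top_le_iff.1 (hS₀ ▸ Subgroup.closure_mono
      (Set.subset_union_left.trans (Set.subset_insert 1 _)))
  have hex := exists_mem_pow_of_closure_eq_top hinv hcl
  obtain ⟨C, d, hC⟩ := hasPolynomialGrowth_of_isNilpotent hfin
  classical
  refine ⟨fun x => Nat.find (hex x), C, d, fun n => ?_, fun g => ?_⟩
  · have hsub : {x | Nat.find (hex x) ≤ n} ⊆ S ^ n := fun x hx =>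
      Set.pow_subset_pow_right h1 hx (Nat.find_spec (hex x))
    exact ⟨(hC n).1.subset hsub, (Set.ncard_le_ncard hsub (hC n).1).trans (hC n).2⟩
  · obtain ⟨K, hK⟩ := hex g
    refine ⟨K, fun x => Nat.find_min' _ ?_⟩
    rw [add_comm, pow_add]
    exact Set.mul_mem_mul hK (Nat.find_spec (hex x))

/-- At most `C * (n + 1) ^ d` elements have length `n`, so with exponent `d + 2` they contribute at
most `C / (n + 1) ^ 2`. -/
theorem summable_inv_length_pow {X : Type*} {len : X → ℕ} {C d : ℕ}
    (h : ∀ n, {x | len x ≤ n}.Finite ∧ {x | len x ≤ n}.ncard ≤ C * (n + 1) ^ d) :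
    Summable fun x => (((len x : ℝ) + 1) ^ (d + 2))⁻¹ := by
  rw [← (Equiv.sigmaFiberEquiv len).summable_iff, summable_sigma_of_nonneg (fun x => by
    simp only [Function.comp_apply]; positivity)]
  have hfib : ∀ n, Finite {x // len x = n} := fun n =>
    ((h n).1.subset fun x (hx : len x = n) => hx.le).to_subtype
  refine ⟨fun n => Summable.of_finite, ?_⟩
  have hs : Summable fun n : ℕ => (C : ℝ) * (((n : ℝ) + 1) ^ 2)⁻¹ := by
    refine Summable.mul_left _ ?_
    have := (summable_nat_add_iff 1).2 (Real.summable_nat_pow_inv.2 one_lt_two)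
    simpa using this
  refine hs.of_nonneg_of_le (fun n => tsum_nonneg fun x => ?_) fun n => ?_
  · simp only [Function.comp_apply]; positivity
  · have hcard : (Nat.card {x // len x = n} : ℝ) ≤ C * (n + 1) ^ d := by
      have : Nat.card {x // len x = n} ≤ C * (n + 1) ^ d :=
        (Set.ncard_le_ncard (fun x (hx : len x = n) => hx.le) (h n).1).trans (h n).2
      exact_mod_cast this
    have : ∀ x : {x // len x = n}, ((fun x => (((len x : ℝ) + 1) ^ (d + 2))⁻¹) ∘
        (Equiv.sigmaFiberEquiv len)) ⟨n, x⟩ = (((n : ℝ) + 1) ^ (d + 2))⁻¹ := by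
      rintro ⟨x, rfl⟩; rfl
    simp_rw [this]
    have := Fintype.ofFinite {x // len x = n}
    rw [tsum_fintype, Finset.sum_const, Finset.card_univ, ← Nat.card_eq_fintype_card, nsmul_eq_mul]
    calc (Nat.card {x // len x = n} : ℝ) * (((n : ℝ) + 1) ^ (d + 2))⁻¹
        ≤ C * (n + 1) ^ d * (((n : ℝ) + 1) ^ (d + 2))⁻¹ := by gcongr
      _ = _ := by rw [pow_add]; field_simp

/-- A finitely generated nilpotent group carries a summable positive function which is
asymptotically invariant under left translations. -/
theorem exists_summable_tendsto_div {G : Type*} [Group G] [Group.IsNilpotent G]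
    (hfg : Group.FG G) : ∃ l : G → ℝ, (∀ x, 0 < l x) ∧ Summable l ∧
      ∀ g, Tendsto (fun x => l x / l (g * x)) cofinite (𝓝 1) := by
  obtain ⟨len, C, d, hC, hK⟩ := exists_length_of_isNilpotent hfg
  refine ⟨fun x => (((len x : ℝ) + 1) ^ (d + 2))⁻¹, fun x => by positivity,
    summable_inv_length_pow hC, fun g => ?_⟩
  have hlen : Tendsto len cofinite atTop := by
    refine tendsto_atTop.2 fun n => ?_
    rw [eventually_cofinite]
    exact (hC n).1.subset fun x (hx : ¬ n ≤ len x) => (not_le.1 hx).le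
  obtain ⟨K, hK1⟩ := hK g
  obtain ⟨K', hK2⟩ := hK g⁻¹
  -- Translation by `g` changes the length by at most `K + K'`, the lower bound coming from `g⁻¹`,
  -- while the length itself tends to infinity.
  have hbase : Tendsto (fun x => ((len (g * x) : ℝ) + 1) / ((len x : ℝ) + 1)) cofinite (𝓝 1) := by
    have h0 : Tendsto (fun x => ((K + K' : ℕ) : ℝ) / ((len x : ℝ) + 1)) cofinite (𝓝 0) :=
      (tendsto_const_nhds.div_atTop (tendsto_natCast_atTop_atTop.atTop_add
        (tendsto_const_nhds (x := (1 : ℝ))))).comp hlen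
    rw [tendsto_iff_norm_sub_tendsto_zero]
    refine squeeze_zero (fun _ => norm_nonneg _) (fun x => ?_) h0
    have hpos : (0 : ℝ) < (len x : ℝ) + 1 := by positivity
    rw [div_sub_one hpos.ne', Real.norm_eq_abs, abs_div, abs_of_pos hpos]
    gcongr
    have e1 : (len (g * x) : ℝ) ≤ len x + K := by exact_mod_cast hK1 x
    have e2 : (len x : ℝ) ≤ len (g * x) + K' := by
      have := hK2 (g * x)
      rw [inv_mul_cancel_left] at this
      exact_mod_cast this
    have e3 : (0 : ℝ) ≤ K := by positivity
    have e4 : (0 : ℝ) ≤ K' := by positivity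
    push_cast
    rw [abs_le]
    constructor <;> linarith
  have := hbase.pow (d + 2)
  rw [one_pow] at this
  refine this.congr fun x => ?_
  rw [div_pow, inv_div_inv]

/-! ### Gaps in the interval and `C^1` maps between them -/

noncomputable section

variable {X : Type*}

/-- The total length of the gaps indexed by `A`, the gap of index `x` having length `π * l x`. -/
def gapMass (l : X → ℝ) (A : Set X) : ℝ := ∑' y : A, π * l y

/-- The left end point of the gap of index `x`, when gaps are placed on the line in order. -/
def gapLeft [LinearOrder X] (l : X → ℝ) (x : X) : ℝ := gapMass l (Set.Iio x)

/-- The gap of index `x`: an open interval of length `π * l x`. -/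
def gap [LinearOrder X] (l : X → ℝ) (x : X) : Set ℝ :=
  Set.Ioo (gapLeft l x) (gapLeft l x + π * l x)

/-- A continuous function supported on the closure of the gap of index `x`. -/
def gapBump [LinearOrder X] (l : X → ℝ) (x : X) (t : ℝ) : ℝ :=
  sin (max 0 (min π ((t - gapLeft l x) / l x))) ^ 2

/-- A parametrization of the gap of index `x` by the line. -/
def gapParam [LinearOrder X] (l : X → ℝ) (x : X) (u : ℝ) : ℝ :=
  gapLeft l x + l x * (π / 2 + arctan (l x * u))

/-- The perturbation of the derivative: zero off the gaps, and small on small gaps. -/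
def gapSum [LinearOrder X] (l c : X → ℝ) (t : ℝ) : ℝ := ∑' x, c x * gapBump l x t

/-- The derivative of `gapMap`. -/
def gapMapDeriv [LinearOrder X] (l l' : X → ℝ) (t : ℝ) : ℝ :=
  (1 + gapSum l (fun x => (l x / l' x) ^ 2 - 1) t)⁻¹

/-- The map of the line which takes the gaps for `l` to the gaps for `l'`. -/
def gapMap [LinearOrder X] (l l' : X → ℝ) (t : ℝ) : ℝ := ∫ s in (0 : ℝ)..t, gapMapDeriv l l' s

theorem gapMass_mono {l : X → ℝ} (hl : ∀ x, 0 < l x) (hs : Summable l) {A B : Set X}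
    (h : A ⊆ B) : gapMass l A ≤ gapMass l B := by
  unfold gapMass
  rw [tsum_subtype A (fun y => π * l y), tsum_subtype B (fun y => π * l y)]
  have hs' := hs.mul_left π
  refine Summable.tsum_le_tsum (fun x => ?_) (hs'.indicator A) (hs'.indicator B)
  exact Set.indicator_le_indicator_of_subset h (fun y => (mul_pos pi_pos (hl y)).le) x

theorem gapMass_nonneg {l : X → ℝ} (hl : ∀ x, 0 < l x) (A : Set X) : 0 ≤ gapMass l A :=
  tsum_nonneg fun y => (mul_pos pi_pos (hl y)).le

theorem gapMass_Iic [LinearOrder X] {l : X → ℝ} (hs : Summable l) (x : X) :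
    gapMass l (Set.Iic x) = gapLeft l x + π * l x := by
  unfold gapLeft gapMass
  have hs' := hs.mul_left π
  rw [← Set.Iio_union_right, Summable.tsum_union_disjoint (by simp) (hs'.subtype _) (hs'.subtype _)]
  simp

theorem gapLeft_add_le [LinearOrder X] {l : X → ℝ} (hl : ∀ x, 0 < l x) (hs : Summable l) {x y : X}
    (h : x < y) : gapLeft l x + π * l x ≤ gapLeft l y := by
  rw [← gapMass_Iic hs]
  exact gapMass_mono hl hs (Set.Iic_subset_Iio.2 h)

theorem gapLeft_add_le_one [LinearOrder X] {l : X → ℝ} (hl : ∀ x, 0 < l x) (hs : Summable l)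
    (h1 : gapMass l Set.univ = 1) (x : X) : gapLeft l x + π * l x ≤ 1 := by
  rw [← gapMass_Iic hs, ← h1]
  exact gapMass_mono hl hs (Set.subset_univ _)

theorem gap_disjoint [LinearOrder X] {l : X → ℝ} (hl : ∀ x, 0 < l x) (hs : Summable l) :
    Pairwise (Function.onFun Disjoint (gap l)) := by
  have key : ∀ x y, x < y → Disjoint (gap l x) (gap l y) := fun x y h =>
    Set.disjoint_left.2 fun t ht ht' =>
      (ht.2.trans_le (gapLeft_add_le hl hs h)).not_gt ht'.1
  intro x y hxy
  rcases lt_or_gt_of_ne hxy with h | h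
  · exact key x y h
  · exact (key y x h).symm

theorem gap_subset_Ioo [LinearOrder X] {l : X → ℝ} (hl : ∀ x, 0 < l x) (hs : Summable l)
    (h1 : gapMass l Set.univ = 1) (x : X) : gap l x ⊆ Set.Ioo 0 1 :=
  Set.Ioo_subset_Ioo (gapMass_nonneg hl _) (gapLeft_add_le_one hl hs h1 x)

theorem countable_of_summable {l : X → ℝ} (hl : ∀ x, 0 < l x) (hs : Summable l) :
    Countable X := by
  have := hs.countable_support
  rwa [show Function.support l = Set.univ from Set.eq_univ_of_forall fun x => (hl x).ne',
    Set.countable_univ_iff] at this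

theorem volume_iUnion_gap [LinearOrder X] {l : X → ℝ} (hl : ∀ x, 0 < l x) (hs : Summable l)
    (A : Set X) : volume (⋃ y : A, gap l y) = ENNReal.ofReal (gapMass l A) := by
  have := countable_of_summable hl hs
  rw [measure_iUnion (f := fun y : A => gap l y) (fun x y hxy => gap_disjoint hl hs (Subtype.coe_injective.ne hxy))
    (fun _ => measurableSet_Ioo), gapMass,
    ENNReal.ofReal_tsum_of_nonneg (f := fun y : A => π * l y) (fun y => (mul_pos pi_pos (hl y)).le)
      ((hs.mul_left π).subtype A)]
  simp [gap]

/-- The gaps indexed by `A` fill up an interval of length `gapMass l A` which contains them. -/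
theorem iUnion_gap_ae_eq [LinearOrder X] {l : X → ℝ} (hl : ∀ x, 0 < l x) (hs : Summable l)
    {A : Set X} (hA : ∀ y ∈ A, gap l y ⊆ Set.Ioc 0 (gapMass l A)) :
    (⋃ y : A, gap l y) =ᵐ[volume] Set.Ioc 0 (gapMass l A) := by
  have := countable_of_summable hl hs
  refine ae_eq_of_subset_of_measure_ge (Set.iUnion_subset fun y => hA y y.2) ?_
    (MeasurableSet.iUnion fun _ => measurableSet_Ioo).nullMeasurableSet (by simp)
  rw [volume_iUnion_gap hl hs]
  simp

/-- The gaps have full measure, and an open null set is empty. -/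
theorem Icc_subset_closure_iUnion_gap [LinearOrder X] {l : X → ℝ} (hl : ∀ x, 0 < l x)
    (hs : Summable l) (h1 : gapMass l Set.univ = 1) :
    Set.Icc 0 1 ⊆ closure (⋃ y, gap l y) := by
  have hae := iUnion_gap_ae_eq hl hs (A := Set.univ)
    (fun y _ => by rw [h1]; exact (gap_subset_Ioo hl hs h1 y).trans Set.Ioo_subset_Ioc_self)
  rw [h1] at hae
  have hU : (⋃ y : (Set.univ : Set X), gap l y) = ⋃ y, gap l y := by
    simp [Set.iUnion_subtype]
  rw [hU] at hae
  have hopen : IsOpen (Set.Ioo (0 : ℝ) 1 \ closure (⋃ y, gap l y)) :=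
    isOpen_Ioo.sdiff isClosed_closure
  have hnull : volume (Set.Ioo (0 : ℝ) 1 \ closure (⋃ y, gap l y)) = 0 := by
    refine measure_mono_null ?_ (ae_le_set.1 hae.symm.le)
    exact Set.sdiff_subset_sdiff Set.Ioo_subset_Ioc_self subset_closure
  have hsub := Set.sdiff_eq_empty.1 (hopen.eq_empty_of_measure_zero hnull)
  rw [← closure_Ioo (zero_ne_one' ℝ)]
  exact closure_minimal hsub isClosed_closure

theorem gapBump_nonneg [LinearOrder X] (l : X → ℝ) (x : X) (t : ℝ) : 0 ≤ gapBump l x t :=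
  sq_nonneg _

theorem gapBump_le_one [LinearOrder X] (l : X → ℝ) (x : X) (t : ℝ) : gapBump l x t ≤ 1 :=
  sin_sq_le_one _

theorem continuous_gapBump [LinearOrder X] (l : X → ℝ) (x : X) : Continuous (gapBump l x) := by
  unfold gapBump
  fun_prop

theorem gapBump_of_notMem [LinearOrder X] {l : X → ℝ} (hl : ∀ x, 0 < l x) {x : X} {t : ℝ}
    (h : t ∉ gap l x) : gapBump l x t = 0 := by
  unfold gapBump
  by_cases h1 : gapLeft l x < t
  · have h2 : gapLeft l x + π * l x ≤ t := not_lt.1 fun h2 => h ⟨h1, h2⟩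
    rw [min_eq_left ((le_div_iff₀ (hl x)).2 (by linarith)), max_eq_right pi_pos.le]
    simp
  · rw [max_eq_left]
    · simp
    · exact (min_le_right _ _).trans (div_nonpos_of_nonpos_of_nonneg (by linarith) (hl x).le)

theorem gapSum_of_mem [LinearOrder X] {l : X → ℝ} (hl : ∀ x, 0 < l x) (hs : Summable l)
    (c : X → ℝ) {x : X} {t : ℝ} (h : t ∈ gap l x) : gapSum l c t = c x * gapBump l x t := by
  refine tsum_eq_single x fun y hy => ?_
  rw [gapBump_of_notMem hl (Set.disjoint_left.1 (gap_disjoint hl hs hy.symm) h), mul_zero]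

theorem gapSum_of_notMem [LinearOrder X] {l : X → ℝ} (hl : ∀ x, 0 < l x)
    (c : X → ℝ) {t : ℝ} (h : ∀ x, t ∉ gap l x) : gapSum l c t = 0 := by
  simp [gapSum, gapBump_of_notMem hl (h _)]

/-- The bumps are at most 1 and live on disjoint gaps, so a tail of the sum is no larger than the
largest coefficient in it: convergence is uniform as soon as `c` tends to 0, without summability of
`c`. -/
theorem continuous_gapSum [LinearOrder X] {l : X → ℝ} (hl : ∀ x, 0 < l x) (hs : Summable l)
    {c : X → ℝ} (hc : Tendsto c cofinite (𝓝 0)) : Continuous (gapSum l c) := by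
  have hu : TendstoUniformly (fun (F : Finset X) t => ∑ x ∈ F, c x * gapBump l x t)
      (gapSum l c) atTop := by
    rw [Metric.tendstoUniformly_iff]
    intro ε hε
    have hfin : {x | ¬ |c x| < ε}.Finite := by
      have := Metric.tendsto_nhds.1 hc ε hε
      simpa [eventually_cofinite] using this
    filter_upwards [eventually_ge_atTop hfin.toFinset] with F hF t
    rw [dist_eq_norm, Real.norm_eq_abs]
    by_cases ht : ∃ x, t ∈ gap l x
    · obtain ⟨x, hx⟩ := ht
      have hz : ∀ y, y ≠ x → c y * gapBump l y t = 0 := fun y hy => by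
        rw [gapBump_of_notMem hl (Set.disjoint_left.1 (gap_disjoint hl hs hy.symm) hx), mul_zero]
      rw [gapSum_of_mem hl hs c hx]
      by_cases hxF : x ∈ F
      · rw [Finset.sum_eq_single x (fun y _ hy => hz y hy) (fun h => (h hxF).elim)]
        simpa using hε
      · rw [Finset.sum_eq_zero fun y hy => hz y fun h => hxF (h ▸ hy), sub_zero, abs_mul,
          abs_of_nonneg (gapBump_nonneg l x t)]
        have hcx : |c x| < ε := by
          by_contra hcon
          exact hxF (hF (hfin.mem_toFinset.2 hcon))
        exact (mul_le_of_le_one_right (abs_nonneg _) (gapBump_le_one l x t)).trans_lt hcx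
    · push Not at ht
      rw [gapSum_of_notMem hl c ht,
        Finset.sum_eq_zero fun y _ => by rw [gapBump_of_notMem hl (ht y), mul_zero]]
      simpa using hε
  exact hu.continuous (Frequently.of_forall fun F =>
    continuous_finsetSum F fun x _ => continuous_const.mul (continuous_gapBump l x))

theorem one_add_gapSum_pos [LinearOrder X] {l : X → ℝ} (hl : ∀ x, 0 < l x) (hs : Summable l)
    {c : X → ℝ} (hc : ∀ x, -1 < c x) (t : ℝ) : 0 < 1 + gapSum l c t := by
  by_cases ht : ∃ x, t ∈ gap l x
  · obtain ⟨x, hx⟩ := ht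
    rw [gapSum_of_mem hl hs c hx]
    have h0 := gapBump_nonneg l x t
    have h1 := gapBump_le_one l x t
    rcases h0.eq_or_lt with h2 | h2
    · rw [← h2]; norm_num
    · nlinarith [mul_pos h2 (neg_lt_iff_pos_add'.1 (hc x))]
  · push Not at ht
    rw [gapSum_of_notMem hl c ht]
    norm_num

/-- Two systems of gaps with the same index set, both filling up the unit interval, whose
lengths are asymptotically the same. -/
structure AsymptoticGaps (l l' : X → ℝ) : Prop where
  pos : ∀ x, 0 < l x
  pos' : ∀ x, 0 < l' x
  summable : Summable l
  summable' : Summable l'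
  mass : gapMass l Set.univ = 1
  mass' : gapMass l' Set.univ = 1
  tendsto_div : Tendsto (fun x => l x / l' x) cofinite (𝓝 1)

namespace AsymptoticGaps

theorem neg_one_lt {l l' : X → ℝ} (h : AsymptoticGaps l l') (x : X) : -1 < (l x / l' x) ^ 2 - 1 := by
  have := pow_pos (div_pos (h.pos x) (h.pos' x)) 2
  linarith

variable [LinearOrder X] {l l' : X → ℝ} (h : AsymptoticGaps l l')
include h

theorem gapMapDeriv_pos (t : ℝ) : 0 < gapMapDeriv l l' t :=
  inv_pos.2 (one_add_gapSum_pos h.pos h.summable h.neg_one_lt t)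

theorem continuous_gapMapDeriv : Continuous (gapMapDeriv l l') := by
  refine Continuous.inv₀ (continuous_const.add (continuous_gapSum h.pos h.summable ?_))
    fun t => (one_add_gapSum_pos h.pos h.summable h.neg_one_lt t).ne'
  simpa using (h.tendsto_div.pow 2).sub_const 1

theorem gapMapDeriv_of_notMem {t : ℝ} (ht : ∀ x, t ∉ gap l x) : gapMapDeriv l l' t = 1 := by
  rw [gapMapDeriv, gapSum_of_notMem h.pos _ ht]
  norm_num

theorem hasDerivAt_gapMap (t : ℝ) : HasDerivAt (gapMap l l') (gapMapDeriv l l' t) t :=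
  intervalIntegral.integral_hasDerivAt_right (h.continuous_gapMapDeriv.intervalIntegrable _ _)
    (h.continuous_gapMapDeriv.stronglyMeasurableAtFilter _ _) h.continuous_gapMapDeriv.continuousAt

theorem contDiff_gapMap : ContDiff ℝ 1 (gapMap l l') := by
  rw [contDiff_one_iff_deriv]
  refine ⟨fun t => (h.hasDerivAt_gapMap t).differentiableAt, ?_⟩
  rw [show deriv (gapMap l l') = gapMapDeriv l l' from funext fun t => (h.hasDerivAt_gapMap t).deriv]
  exact h.continuous_gapMapDeriv

theorem strictMono_gapMap : StrictMono (gapMap l l') :=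
  strictMono_of_hasDerivAt_pos h.hasDerivAt_gapMap h.gapMapDeriv_pos

theorem gapMap_sub (s t : ℝ) :
    gapMap l l' t - gapMap l l' s = ∫ r in s..t, gapMapDeriv l l' r :=
  intervalIntegral.integral_interval_sub_left (h.continuous_gapMapDeriv.intervalIntegrable _ _)
    (h.continuous_gapMapDeriv.intervalIntegrable _ _)

end AsymptoticGaps

theorem hasDerivAt_gapParam [LinearOrder X] (l : X → ℝ) (x : X) (u : ℝ) :
    HasDerivAt (gapParam l x) (l x ^ 2 / (1 + (l x * u) ^ 2)) u := by
  have h1 : HasDerivAt (fun u => l x * u) (l x) u := by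
    simpa using (hasDerivAt_id u).const_mul (l x)
  have h2 := ((h1.arctan.const_add (π / 2)).const_mul (l x)).const_add (gapLeft l x)
  refine h2.congr_deriv ?_
  ring

theorem gapParam_mem_gap [LinearOrder X] {l : X → ℝ} (hl : ∀ x, 0 < l x) (x : X) (u : ℝ) :
    gapParam l x u ∈ gap l x := by
  have h1 := neg_pi_div_two_lt_arctan (l x * u)
  have h2 := arctan_lt_pi_div_two (l x * u)
  have h3 := hl x
  unfold gapParam
  constructor <;> nlinarith

theorem exists_gapParam_eq [LinearOrder X] {l : X → ℝ} (hl : ∀ x, 0 < l x) {x : X} {t : ℝ}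
    (ht : t ∈ gap l x) : ∃ u, gapParam l x u = t := by
  refine ⟨tan ((t - gapLeft l x) / l x - π / 2) / l x, ?_⟩
  have h3 := hl x
  have h1 : 0 < (t - gapLeft l x) / l x := div_pos (sub_pos.2 ht.1) h3
  have h2 : (t - gapLeft l x) / l x < π := by
    rw [div_lt_iff₀ h3]; linarith [ht.2]
  rw [gapParam, mul_div_cancel₀ _ h3.ne', arctan_tan (by linarith) (by linarith)]
  field_simp
  ring

theorem tendsto_gapParam_atBot [LinearOrder X] {l : X → ℝ} (hl : ∀ x, 0 < l x) (x : X) :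
    Tendsto (gapParam l x) atBot (𝓝 (gapLeft l x)) := by
  have h1 : Tendsto (fun u => arctan (l x * u)) atBot (𝓝 (-(π / 2))) :=
    (tendsto_arctan_atBot.mono_right nhdsWithin_le_nhds).comp
      (tendsto_id.const_mul_atBot (hl x))
  have h2 := ((h1.const_add (π / 2)).const_mul (l x)).const_add (gapLeft l x)
  rwa [add_neg_cancel, mul_zero, add_zero] at h2

theorem tendsto_gapParam_atTop [LinearOrder X] {l : X → ℝ} (hl : ∀ x, 0 < l x) (x : X) :
    Tendsto (gapParam l x) atTop (𝓝 (gapLeft l x + π * l x)) := by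
  have h1 : Tendsto (fun u => arctan (l x * u)) atTop (𝓝 (π / 2)) :=
    (tendsto_arctan_atTop.mono_right nhdsWithin_le_nhds).comp
      (tendsto_id.const_mul_atTop (hl x))
  have h2 := ((h1.const_add (π / 2)).const_mul (l x)).const_add (gapLeft l x)
  rwa [add_halves, mul_comm] at h2

/-- On the gap the clamped argument of the sine is `arctan (l x * u) + π / 2`, so the bump is the
squared cosine of an arctangent. -/
theorem gapBump_gapParam [LinearOrder X] {l : X → ℝ} (hl : ∀ x, 0 < l x) (x : X) (u : ℝ) :
    gapBump l x (gapParam l x u) = (1 + (l x * u) ^ 2)⁻¹ := by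
  have h1 := neg_pi_div_two_lt_arctan (l x * u)
  have h2 := arctan_lt_pi_div_two (l x * u)
  have h3 : (gapParam l x u - gapLeft l x) / l x = arctan (l x * u) + π / 2 := by
    rw [gapParam, add_sub_cancel_left, mul_div_cancel_left₀ _ (hl x).ne', add_comm]
  rw [gapBump, h3, min_eq_right (by linarith), max_eq_right (by linarith), sin_add_pi_div_two,
    cos_sq_arctan, one_div]

namespace AsymptoticGaps

variable [LinearOrder X] {l l' : X → ℝ} (h : AsymptoticGaps l l')
include h

/-- The coefficient `(l x / l' x) ^ 2 - 1` is chosen for this: by the chain rule, `gapMap l l'`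
turns the speed of one parametrization into that of the other. -/
theorem gapMapDeriv_gapParam_mul (x : X) (u : ℝ) :
    gapMapDeriv l l' (gapParam l x u) * (l x ^ 2 / (1 + (l x * u) ^ 2)) =
      l' x ^ 2 / (1 + (l' x * u) ^ 2) := by
  rw [gapMapDeriv, gapSum_of_mem h.pos h.summable _ (gapParam_mem_gap h.pos x u),
    gapBump_gapParam h.pos]
  have h1 := h.pos x
  have h2 := h.pos' x
  have h3 : 0 < 1 + (l x * u) ^ 2 := by positivity
  have h4 : 0 < 1 + (l' x * u) ^ 2 := by positivity
  have h5 : 1 + ((l x / l' x) ^ 2 - 1) * (1 + (l x * u) ^ 2)⁻¹ =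
      l x ^ 2 * (1 + (l' x * u) ^ 2) / (l' x ^ 2 * (1 + (l x * u) ^ 2)) := by
    field_simp
    ring
  rw [h5]
  field_simp

/-- The difference has zero derivative in `u`, so it equals its limits at both ends of the gap.
Comparing the two limits gives the length of the image before its position is known. -/
theorem gapMap_gapParam_sub (x : X) (u : ℝ) :
    gapMap l l' (gapParam l x u) - gapParam l' x u =
      gapMap l l' (gapLeft l x) - gapLeft l' x ∧
    gapMap l l' (gapParam l x u) - gapParam l' x u =
      gapMap l l' (gapLeft l x + π * l x) - (gapLeft l' x + π * l' x) := by
  have hd : ∀ u, HasDerivAt (fun u => gapMap l l' (gapParam l x u) - gapParam l' x u) 0 u := by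
    intro u
    have h1 := (h.hasDerivAt_gapMap (gapParam l x u)).comp u (hasDerivAt_gapParam l x u)
    rw [h.gapMapDeriv_gapParam_mul] at h1
    have h2 := h1.sub (hasDerivAt_gapParam l' x u)
    rwa [sub_self] at h2
  have hconst : ∀ v, gapMap l l' (gapParam l x v) - gapParam l' x v =
      gapMap l l' (gapParam l x u) - gapParam l' x u := fun v =>
    is_const_of_deriv_eq_zero (fun u => (hd u).differentiableAt) (fun u => (hd u).deriv) v u
  have hcont := h.contDiff_gapMap.continuous
  constructor
  · refine tendsto_nhds_unique (f := fun _ : ℝ => _) (l := atBot) tendsto_const_nhds ?_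
    refine Tendsto.congr hconst ?_
    exact ((hcont.tendsto _).comp (tendsto_gapParam_atBot h.pos x)).sub
      (tendsto_gapParam_atBot h.pos' x)
  · refine tendsto_nhds_unique (f := fun _ : ℝ => _) (l := atTop) tendsto_const_nhds ?_
    refine Tendsto.congr hconst ?_
    exact ((hcont.tendsto _).comp (tendsto_gapParam_atTop h.pos x)).sub
      (tendsto_gapParam_atTop h.pos' x)

theorem setIntegral_gap (x : X) : ∫ r in gap l x, gapMapDeriv l l' r = π * l' x := by
  obtain ⟨h1, h2⟩ := h.gapMap_gapParam_sub x 0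
  have h3 := h.gapMap_sub (gapLeft l x) (gapLeft l x + π * l x)
  rw [gap, ← integral_Ioc_eq_integral_Ioo, ← intervalIntegral.integral_of_le
    (by nlinarith [pi_pos, h.pos x]), ← h3]
  linarith

/-- The gaps of `A` fill the interval up to a null set, so the derivative integrates to the sum of
its integrals over them. For initial segments this puts left end points in place; for all of `X` it
fixes 1. -/
theorem gapMap_gapMass {A : Set X} (hA : ∀ y ∈ A, gap l y ⊆ Set.Ioc 0 (gapMass l A)) :
    gapMap l l' (gapMass l A) = gapMass l' A := by
  have := countable_of_summable h.pos h.summable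
  have hae := iUnion_gap_ae_eq h.pos h.summable hA
  rw [gapMap, intervalIntegral.integral_of_le (gapMass_nonneg h.pos A),
    ← setIntegral_congr_set hae, integral_iUnion (s := fun y : A => gap l y) (fun _ => measurableSet_Ioo)
    (fun x y hxy => gap_disjoint h.pos h.summable (Subtype.coe_injective.ne hxy))]
  · simp_rw [h.setIntegral_gap]
    rfl
  · rw [integrableOn_congr_set_ae hae]
    exact (h.continuous_gapMapDeriv.integrableOn_Icc).mono_set Set.Ioc_subset_Icc_self

theorem gapMap_gapLeft (x : X) : gapMap l l' (gapLeft l x) = gapLeft l' x := by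
  refine h.gapMap_gapMass fun y hy t ht => ⟨(gapMass_nonneg h.pos _).trans_lt ht.1, ?_⟩
  exact ht.2.le.trans (gapLeft_add_le h.pos h.summable hy)

theorem gapMap_gapParam (x : X) (u : ℝ) : gapMap l l' (gapParam l x u) = gapParam l' x u := by
  have := (h.gapMap_gapParam_sub x u).1
  rwa [h.gapMap_gapLeft, sub_self, sub_eq_zero] at this

theorem gapMap_of_nonpos {t : ℝ} (ht : t ≤ 0) : gapMap l l' t = t := by
  rw [gapMap, intervalIntegral.integral_congr (g := fun _ => 1)]
  · simp
  · intro s hs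
    rw [Set.uIcc_of_ge ht] at hs
    exact h.gapMapDeriv_of_notMem fun x hx =>
      (gap_subset_Ioo h.pos h.summable h.mass x hx).1.not_ge hs.2

theorem gapMap_of_one_le {t : ℝ} (ht : 1 ≤ t) : gapMap l l' t = t := by
  have h1 : gapMap l l' 1 = 1 := by
    have := h.gapMap_gapMass (A := Set.univ) (fun y _ => by
      rw [h.mass]
      exact (gap_subset_Ioo h.pos h.summable h.mass y).trans Set.Ioo_subset_Ioc_self)
    rwa [h.mass, h.mass'] at this
  have h2 := h.gapMap_sub 1 t
  rw [h1, intervalIntegral.integral_congr (g := fun _ => 1)] at h2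
  · simpa using h2
  · intro s hs
    rw [Set.uIcc_of_le ht] at hs
    exact h.gapMapDeriv_of_notMem fun x hx =>
      (gap_subset_Ioo h.pos h.summable h.mass x hx).2.not_ge hs.1

end AsymptoticGaps

/-- Continuous maps of the line which agree on all gaps and outside the unit interval are equal. -/
theorem eq_of_eq_on_gaps [LinearOrder X] {l : X → ℝ} (hl : ∀ x, 0 < l x) (hs : Summable l)
    (h1 : gapMass l Set.univ = 1) {f g : ℝ → ℝ} (hf : Continuous f) (hg : Continuous g)
    (hgap : ∀ x u, f (gapParam l x u) = g (gapParam l x u)) (h0 : ∀ t ≤ 0, f t = g t)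
    (h1' : ∀ t, 1 ≤ t → f t = g t) : f = g := by
  have hU : Set.EqOn f g (closure (⋃ y, gap l y)) := by
    refine Set.EqOn.closure (fun t ht => ?_) hf hg
    obtain ⟨x, hx⟩ := Set.mem_iUnion.1 ht
    obtain ⟨u, rfl⟩ := exists_gapParam_eq hl hx
    exact hgap x u
  ext t
  rcases le_total t 0 with h | h
  · exact h0 t h
  · rcases le_total 1 t with h' | h'
    · exact h1' t h'
    · exact hU (Icc_subset_closure_iUnion_gap hl hs h1 ⟨h, h'⟩)

end

/-! ### The action on the unit interval -/

/-- An action of a group on the line by orientation-preserving `C^1` diffeomorphisms supported in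
the unit interval, in which only the identity acts trivially. -/
structure IsUnitIntervalAction {N : Type*} [Group N] (F : N → ℝ → ℝ) : Prop where
  map_one : F 1 = id
  map_mul : ∀ g h, F (g * h) = F g ∘ F h
  contDiff : ∀ g, ContDiff ℝ 1 (F g)
  strictMono : ∀ g, StrictMono (F g)
  of_nonpos : ∀ g t, t ≤ 0 → F g t = t
  of_one_le : ∀ g t, 1 ≤ t → F g t = t
  eq_one : ∀ g, F g = id → g = 1

section Construction

variable {N : Type*} [Group N] (l : N → ℝ)

theorem gapMass_translate (g : N) (A : Set N) :
    gapMass (fun x => l (g * x)) A = gapMass l ((g * ·) '' A) :=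
  (Equiv.Set.image (g * ·) A (mul_right_injective g)).tsum_eq
    (fun y : ((g * ·) '' A : Set N) => π * l y)

variable [LinearOrder N] (hlt : ∀ g x y : N, x < y → g * x < g * y)
include hlt

/-- Invariance of the order enters here: translation by `g` maps the predecessors of `x` onto those
of `g * x`. -/
theorem gapLeft_translate (g x : N) : gapLeft (fun x => l (g * x)) x = gapLeft l (g * x) := by
  rw [gapLeft, gapMass_translate, gapLeft]
  congr 1
  ext y
  simp only [Set.mem_image, Set.mem_Iio]
  constructor
  · rintro ⟨z, hz, rfl⟩
    exact hlt g z x hz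
  · intro hy
    exact ⟨g⁻¹ * y, by simpa using hlt g⁻¹ _ _ hy, by simp⟩

theorem gapParam_translate (g x : N) (u : ℝ) :
    gapParam (fun x => l (g * x)) x u = gapParam l (g * x) u := by
  rw [gapParam, gapLeft_translate l hlt, gapParam]

end Construction

/-- Each `g` acts by `gapMap` from the weights `l` to their translates by `g`, hence sends the point
of parameter `u` in the gap of `x` to that in the gap of `g * x`. The group law holds on the dense
gaps, so everywhere; if `g ≠ 1`, the gap of 1 moves to a disjoint one. -/
theorem exists_isUnitIntervalAction {N : Type*} [Group N] [Group.IsNilpotent N]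
    (hfg : Group.FG N) (htf : ∀ g : N, IsOfFinOrder g → g = 1) :
    ∃ F : N → ℝ → ℝ, IsUnitIntervalAction F := by
  obtain ⟨_, hlt⟩ := exists_linearOrder_mul_left_lt htf
  obtain ⟨l₀, hpos₀, hsum₀, hlim₀⟩ := exists_summable_tendsto_div hfg
  have hT : 0 < π * ∑' x, l₀ x := mul_pos pi_pos (hsum₀.tsum_pos (fun x => (hpos₀ x).le) 1 (hpos₀ 1))
  -- Normalized so that the gaps, of lengths `π * l x`, have total length 1.
  let l : N → ℝ := fun x => l₀ x / (π * ∑' x, l₀ x)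
  have hpos : ∀ x, 0 < l x := fun x => div_pos (hpos₀ x) hT
  have hsum : Summable l := hsum₀.div_const _
  have hmass : gapMass l Set.univ = 1 := by
    rw [gapMass, tsum_univ (fun y => π * l y), tsum_mul_left, tsum_div_const, ← mul_div_assoc,
      div_self hT.ne']
  have h : ∀ g : N, AsymptoticGaps l (fun x => l (g * x)) := fun g =>
    { pos := hpos
      pos' := fun x => hpos _
      summable := hsum
      summable' := (Equiv.mulLeft g).summable_iff.2 hsum
      mass := hmass
      mass' := by
        rw [gapMass_translate, Set.image_univ_of_surjective (mul_left_surjective g), hmass]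
      tendsto_div := (hlim₀ g).congr fun x => (div_div_div_cancel_right₀ hT.ne' _ _).symm }
  have hparam : ∀ g x u, gapMap l (fun x => l (g * x)) (gapParam l x u) = gapParam l (g * x) u :=
    fun g x u => by rw [(h g).gapMap_gapParam, gapParam_translate l hlt]
  have hcont := fun g => (h g).contDiff_gapMap.continuous
  refine ⟨fun g => gapMap l fun x => l (g * x), ?_, fun g k => ?_, fun g => (h g).contDiff_gapMap,
    fun g => (h g).strictMono_gapMap, fun g t => (h g).gapMap_of_nonpos,
    fun g t => (h g).gapMap_of_one_le, fun g hg => ?_⟩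
  · refine eq_of_eq_on_gaps hpos hsum hmass (hcont 1) continuous_id (fun x u => ?_)
      (fun t ht => (h 1).gapMap_of_nonpos ht) (fun t ht => (h 1).gapMap_of_one_le ht)
    rw [hparam, one_mul, id]
  · refine eq_of_eq_on_gaps hpos hsum hmass (hcont _) ((hcont g).comp (hcont k)) (fun x u => ?_)
      (fun t ht => ?_) (fun t ht => ?_)
    · rw [Function.comp_apply, hparam, hparam, hparam, mul_assoc]
    · rw [Function.comp_apply, (h k).gapMap_of_nonpos ht, (h g).gapMap_of_nonpos ht,
        (h _).gapMap_of_nonpos ht]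
    · rw [Function.comp_apply, (h k).gapMap_of_one_le ht, (h g).gapMap_of_one_le ht,
        (h _).gapMap_of_one_le ht]
  · by_contra hne
    have h1 := hparam g 1 0
    rw [hg, id, mul_one] at h1
    have h2 := gapParam_mem_gap hpos (1 : N) 0
    rw [h1] at h2
    exact Set.disjoint_left.1 (gap_disjoint hpos hsum hne) (gapParam_mem_gap hpos g 0) h2

/-! ### From the unit interval to the line, the interval and the circle -/

/-- An injective homomorphism identifies its source with a subgroup of its target. -/
theorem exists_subgroup_mulEquiv {N G : Type*} [Group N] [Group G] (φ : N →* G)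
    (hφ : Function.Injective φ) : ∃ H : Subgroup G, Nonempty (N ≃* H) :=
  ⟨φ.range, ⟨MonoidHom.ofInjective hφ⟩⟩

namespace IsUnitIntervalAction

variable {N : Type*} [Group N] {F : N → ℝ → ℝ} (hF : IsUnitIntervalAction F)
include hF

theorem inv_apply_apply (g : N) (t : ℝ) : F g⁻¹ (F g t) = t := by
  rw [← Function.comp_apply (f := F g⁻¹), ← hF.map_mul, inv_mul_cancel, hF.map_one, id]

theorem apply_inv_apply (g : N) (t : ℝ) : F g (F g⁻¹ t) = t := by
  simpa using hF.inv_apply_apply g⁻¹ t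

theorem mul_apply (g h : N) (t : ℝ) : F (g * h) t = F g (F h t) := by
  rw [hF.map_mul, Function.comp_apply]

theorem eq_one_of_forall_Ioo (g : N) (h : ∀ t ∈ Set.Ioo (0 : ℝ) 1, F g t = t) : g = 1 := by
  refine hF.eq_one g (funext fun t => ?_)
  by_cases h0 : t ≤ 0
  · exact hF.of_nonpos g t h0
  · by_cases h1 : 1 ≤ t
    · exact hF.of_one_le g t h1
    · exact h t ⟨not_le.1 h0, not_le.1 h1⟩

/-- The diffeomorphism of the line defined by an element of the group. -/
def lineDiffeomorph (g : N) : Diffeomorph 𝓘(ℝ, ℝ) 𝓘(ℝ, ℝ) ℝ ℝ 1 where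
  toFun := F g
  invFun := F g⁻¹
  left_inv := hF.inv_apply_apply g
  right_inv := hF.apply_inv_apply g
  contMDiff_toFun := (hF.contDiff g).contMDiff
  contMDiff_invFun := (hF.contDiff g⁻¹).contMDiff

/-- The homomorphism to `Diff^1(ℝ)` defined by the action. -/
def lineHom : N →* DiffOneLine where
  toFun g := ⟨hF.lineDiffeomorph g, hF.strictMono g⟩
  map_one' := Subtype.ext (Diffeomorph.ext fun t => congrFun hF.map_one t)
  map_mul' g h := Subtype.ext (Diffeomorph.ext fun t => hF.mul_apply g h t)

theorem lineHom_injective : Function.Injective hF.lineHom := by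
  rw [injective_iff_map_eq_one]
  intro g hg
  refine hF.eq_one_of_forall_Ioo g fun t _ => ?_
  have := congrArg (fun f : DiffOneLine => f.1 t) hg
  exact this

theorem mem_Icc (g : N) {t : ℝ} (ht : t ∈ Set.Icc (0 : ℝ) 1) : F g t ∈ Set.Icc (0 : ℝ) 1 := by
  constructor
  · rw [← hF.of_nonpos g 0 le_rfl]
    exact (hF.strictMono g).monotone ht.1
  · rw [← hF.of_one_le g 1 le_rfl]
    exact (hF.strictMono g).monotone ht.2

theorem contMDiff_Icc (g : N) : ContMDiff (𝓡∂ 1) (𝓡∂ 1) 1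
    (fun t : Set.Icc (0 : ℝ) 1 => (⟨F g t, hF.mem_Icc g t.2⟩ : Set.Icc (0 : ℝ) 1)) := by
  rw [contMDiff_iff_comp_subtypeVal_Icc]
  constructor
  · exact ((hF.contDiff g).continuous.comp continuous_subtype_val).subtype_mk _
  · exact (hF.contDiff g).contMDiff.comp contMDiff_subtypeVal_Icc

/-- The diffeomorphism of the unit interval defined by an element of the group. -/
def intervalDiffeomorph (g : N) :
    Diffeomorph (𝓡∂ 1) (𝓡∂ 1) (Set.Icc (0 : ℝ) 1) (Set.Icc (0 : ℝ) 1) 1 where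
  toFun t := ⟨F g t, hF.mem_Icc g t.2⟩
  invFun t := ⟨F g⁻¹ t, hF.mem_Icc g⁻¹ t.2⟩
  left_inv t := Subtype.ext (hF.inv_apply_apply g t)
  right_inv t := Subtype.ext (hF.apply_inv_apply g t)
  contMDiff_toFun := hF.contMDiff_Icc g
  contMDiff_invFun := hF.contMDiff_Icc g⁻¹

/-- The homomorphism to `Diff^1([0,1])` defined by the action. -/
def intervalHom : N →* DiffOneInterval where
  toFun g := ⟨hF.intervalDiffeomorph g, fun _ _ hst => hF.strictMono g hst⟩
  map_one' := Subtype.ext (Diffeomorph.ext fun t => Subtype.ext (congrFun hF.map_one t))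
  map_mul' g h := Subtype.ext (Diffeomorph.ext fun t => Subtype.ext (hF.mul_apply g h t))

theorem intervalHom_injective : Function.Injective hF.intervalHom := by
  rw [injective_iff_map_eq_one]
  intro g hg
  refine hF.eq_one_of_forall_Ioo g fun t ht => ?_
  have := congrArg (fun f : DiffOneInterval => (f.1 ⟨t, Set.Ioo_subset_Icc_self ht⟩ : ℝ)) hg
  exact this

/-- The range of the argument contains `[0,1]`, outside which the action is trivial, so the action
preserves it and transfers to the circle through the argument. -/
theorem mem_Ioc (g : N) {t : ℝ} (ht : t ∈ Set.Ioc (-π) π) : F g t ∈ Set.Ioc (-π) π := by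
  have h3 := pi_gt_three
  constructor
  · rw [← hF.of_nonpos g (-π) (by linarith)]
    exact hF.strictMono g ht.1
  · rw [← hF.of_one_le g π (by linarith)]
    exact (hF.strictMono g).monotone ht.2

theorem circle_mul_apply (g h : N) (z : Circle) :
    Circle.exp (F g (Complex.arg (Circle.exp (F h (Complex.arg z))))) =
      Circle.exp (F (g * h) (Complex.arg z)) := by
  have h1 := hF.mem_Ioc h (Complex.arg_mem_Ioc z)
  rw [Circle.arg_exp h1.1 h1.2, hF.mul_apply]

theorem circle_one_apply (z : Circle) : Circle.exp (F 1 (Complex.arg z)) = z := by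
  rw [hF.map_one, id, Circle.exp_arg]

/-- The argument is smooth off the negative real axis. Near that axis its absolute value exceeds `π
/ 2 > 1`, so the map is the identity there. -/
theorem contMDiff_circle (g : N) : ContMDiff (𝓡 1) (𝓡 1) 1
    (fun z : Circle => Circle.exp (F g (Complex.arg z))) := by
  intro z
  by_cases hz : (z : ℂ) ∈ Complex.slitPlane
  · have h1 : ContDiffAt ℝ 1 Complex.arg (z : ℂ) := by
      have h2 : ContDiffAt ℝ 1 Complex.log (z : ℂ) :=
        (Complex.contDiffAt_log hz).restrict_scalars ℝ
      refine (Complex.imCLM.contDiff.contDiffAt.comp _ h2).congr_of_eventuallyEq ?_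
      exact Eventually.of_forall fun w => (Complex.log_im w).symm
    have h3 : ContDiffAt ℝ 1 (fun w => F g (Complex.arg w)) (z : ℂ) :=
      (hF.contDiff g).contDiffAt.comp _ h1
    have : Fact (Module.finrank ℝ ℂ = 1 + 1) := ⟨Complex.finrank_real_complex⟩
    have h4 : ContMDiffAt (𝓡 1) 𝓘(ℝ, ℂ) 1 (fun w : Circle => (w : ℂ)) z :=
      contMDiff_coe_sphere (E := ℂ) z
    exact (contMDiff_circleExp _).comp z (h3.contMDiffAt.comp z h4)
  · have hre : (z : ℂ).re < 0 := by
      rw [Complex.mem_slitPlane_iff] at hz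
      push Not at hz
      refine hz.1.lt_of_ne fun h0 => ?_
      exact Circle.coe_ne_zero z (Complex.ext h0 hz.2)
    have hopen : IsOpen {w : Circle | (w : ℂ).re < 0} :=
      isOpen_lt (Complex.continuous_re.comp continuous_subtype_val) continuous_const
    refine contMDiffAt_id.congr_of_eventuallyEq ?_
    filter_upwards [hopen.mem_nhds hre] with w hw
    have h1 : ¬ |Complex.arg w| ≤ π / 2 := by
      rw [Complex.abs_arg_le_pi_div_two_iff]
      exact not_le.2 hw
    have h2 : F g (Complex.arg w) = Complex.arg w := by
      have h3 := pi_gt_three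
      by_cases h0 : Complex.arg (w : ℂ) ≤ 0
      · exact hF.of_nonpos g _ h0
      · rw [abs_of_pos (not_le.1 h0)] at h1
        exact hF.of_one_le g _ (by linarith)
    rw [h2, Circle.exp_arg, id]

/-- The diffeomorphism of the circle defined by an element of the group. -/
noncomputable def circleDiffeomorph (g : N) : Diffeomorph (𝓡 1) (𝓡 1) Circle Circle 1 where
  toFun z := Circle.exp (F g (Complex.arg z))
  invFun z := Circle.exp (F g⁻¹ (Complex.arg z))
  left_inv z := (hF.circle_mul_apply g⁻¹ g z).trans
    (by rw [inv_mul_cancel, hF.circle_one_apply])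
  right_inv z := (hF.circle_mul_apply g g⁻¹ z).trans
    (by rw [mul_inv_cancel, hF.circle_one_apply])
  contMDiff_toFun := hF.contMDiff_circle g
  contMDiff_invFun := hF.contMDiff_circle g⁻¹

omit hF in
/-- The lift to the line of a circle map, given on a fundamental domain. -/
noncomputable def periodicLift (f : ℝ → ℝ) (t : ℝ) : ℝ :=
  f (toIocMod two_pi_pos (-π) t) + toIocDiv two_pi_pos (-π) t • (2 * π)

omit hF in
theorem toIocMod_mem_Ioc_neg_pi (t : ℝ) : toIocMod two_pi_pos (-π) t ∈ Set.Ioc (-π) π := by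
  have := toIocMod_mem_Ioc two_pi_pos (-π) t
  rwa [show -π + 2 * π = π by ring] at this

/-- The action preserves the fundamental domain, so `periodicLift (F h)` leaves the number of the
period unchanged. -/
theorem periodicLift_mul (g h : N) (t : ℝ) :
    periodicLift (F (g * h)) t = periodicLift (F g) (periodicLift (F h) t) := by
  have h1 := hF.mem_Ioc h (toIocMod_mem_Ioc_neg_pi t)
  have h2 : toIocMod two_pi_pos (-π) (F h (toIocMod two_pi_pos (-π) t)) =
      F h (toIocMod two_pi_pos (-π) t) := by
    rw [toIocMod_eq_self, show -π + 2 * π = π by ring]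
    exact h1
  have h3 : toIocDiv two_pi_pos (-π) (F h (toIocMod two_pi_pos (-π) t)) = 0 := by
    refine toIocDiv_eq_of_sub_zsmul_mem_Ioc _ ?_
    rw [zero_smul, sub_zero, show -π + 2 * π = π by ring]
    exact h1
  simp only [periodicLift, toIocMod_add_zsmul, toIocDiv_add_zsmul, h2, h3, zero_add, hF.mul_apply]

theorem periodicLift_one (t : ℝ) : periodicLift (F 1) t = t := by
  rw [periodicLift, hF.map_one, id, toIocMod_add_toIocDiv_zsmul]

theorem strictMono_periodicLift (g : N) : StrictMono (periodicLift (F g)) := by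
  intro s t hst
  have hs := toIocMod_add_toIocDiv_zsmul two_pi_pos (-π) s
  have ht := toIocMod_add_toIocDiv_zsmul two_pi_pos (-π) t
  have hs1 := toIocMod_mem_Ioc_neg_pi s
  have ht1 := toIocMod_mem_Ioc_neg_pi t
  have hs2 := hF.mem_Ioc g hs1
  have ht2 := hF.mem_Ioc g ht1
  unfold periodicLift
  set ms := toIocMod two_pi_pos (-π) s
  set mt := toIocMod two_pi_pos (-π) t
  set ks := toIocDiv two_pi_pos (-π) s
  set kt := toIocDiv two_pi_pos (-π) t
  rw [zsmul_eq_mul] at hs ht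
  rw [zsmul_eq_mul, zsmul_eq_mul]
  have hpi := pi_pos
  rcases lt_trichotomy ks kt with hk | hk | hk
  · have : (ks : ℝ) + 1 ≤ kt := by exact_mod_cast hk
    nlinarith [hs2.2, ht2.1]
  · rw [hk] at hs ⊢
    have : ms < mt := by linarith
    have := hF.strictMono g this
    linarith
  · have : (kt : ℝ) + 1 ≤ ks := by exact_mod_cast hk
    nlinarith [hs1.1, ht1.2]

theorem circleDiffeomorph_mem (g : N) : hF.circleDiffeomorph g ∈ DiffOneCircle := by
  refine ⟨(hF.strictMono_periodicLift g).orderIsoOfRightInverse _ (periodicLift (F g⁻¹))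
    fun t => ?_, fun t => ?_⟩
  · rw [← hF.periodicLift_mul, mul_inv_cancel, hF.periodicLift_one]
  · change Circle.exp (F g (Complex.arg (Circle.exp t))) = Circle.exp (periodicLift (F g) t)
    rw [Circle.coe_exp, Complex.arg_exp_mul_I, periodicLift, zsmul_eq_mul, Circle.exp_add,
      Circle.exp_int_mul_two_pi, mul_one]

/-- The homomorphism to `Diff^1(S^1)` defined by the action. -/
noncomputable def circleHom : N →* DiffOneCircle where
  toFun g := ⟨hF.circleDiffeomorph g, hF.circleDiffeomorph_mem g⟩
  map_one' := Subtype.ext (Diffeomorph.ext fun z => hF.circle_one_apply z)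
  map_mul' g h := Subtype.ext (Diffeomorph.ext fun z => (hF.circle_mul_apply g h z).symm)

/-- On `(-π, π]` the argument inverts the exponential, so the circle map determines `F g` on `(0,
1)`. -/
theorem circleHom_injective : Function.Injective hF.circleHom := by
  rw [injective_iff_map_eq_one]
  intro g hg
  refine hF.eq_one_of_forall_Ioo g fun t ht => ?_
  have h3 := pi_gt_three
  have ht' : t ∈ Set.Ioc (-π) π := ⟨by linarith [ht.1], by linarith [ht.2]⟩
  have h1 : Circle.exp (F g (Complex.arg (Circle.exp t))) = Circle.exp t :=
    congrArg (fun f : DiffOneCircle => f.1 (Circle.exp t)) hg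
  rw [Circle.arg_exp ht'.1 ht'.2] at h1
  have h2 := hF.mem_Ioc g ht'
  rw [← Circle.arg_exp h2.1 h2.2, h1, Circle.arg_exp ht'.1 ht'.2]

end IsUnitIntervalAction

theorem mainTheorem1 {N : Type*} [Group N] (hfg : Group.FG N) (hnil : Group.IsNilpotent N)
    (htf : ∀ g : N, IsOfFinOrder g → g = 1) :
    (∃ H : Subgroup DiffOneLine, Nonempty (N ≃* H)) ∧
    (∃ H : Subgroup DiffOneCircle, Nonempty (N ≃* H)) ∧
    (∃ H : Subgroup DiffOneInterval, Nonempty (N ≃* H)) := by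
  obtain ⟨F, hF⟩ := exists_isUnitIntervalAction hfg htf
  exact ⟨exists_subgroup_mulEquiv hF.lineHom hF.lineHom_injective,
    exists_subgroup_mulEquiv hF.circleHom hF.circleHom_injective,
    exists_subgroup_mulEquiv hF.intervalHom hF.intervalHom_injective⟩
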